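/- Let $A_0, A_0', A_1$ be (nonzero) finite-dimensional quantum systems, with state spaces (sets of density operators) $\mathfrak S(\cdot)$, and let $\Phi_1\in\mathcal C(A_0,A_1)$ and $\Phi_2\in\mathcal C(A_0',A_1)$ be quantum channels, i.e. completely positive trace preserving linear maps. The preprocessing deficiency is $$\delta_{\mathrm{pre}}(\Phi_1\|\Phi_2):=\min_{\Lambda\in\mathcal C(A_0',A_0)}\|\Phi_1\circ\Lambda-\Phi_2\|_\diamond ,$$ where $\|\Psi\|_\diamond=\max_{\rho\in\mathfrak S(A_0'A_0')}\|(\Psi\otimes \mathrm{id})(\rho)\|_1$ for linear maps $\Psi$ from operators on $A_0'$ to operators on $A_1$, and $\|X\|_1=\mathrm{Tr}\,|X|$; the minimum over $\Lambda$ is attained. For an operator $X$ on $AR$ write $X_R=\mathrm{Tr}_A X$, and write $\mathcal R(\Phi_1\otimes \mathrm{id}_R)=(\Phi_1\otimes \mathrm{id}_R)(\mathfrak S(A_0R))$ and $\mathcal R(\Phi_2\otimes \mathrm{id}_R)=(\Phi_2\otimes \mathrm{id}_R)(\mathfrak S(A_0'R))$ for the ranges. Then: 1. For every system $R$ with $R\simeq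 A_0'$ (i.e. $\dim R=\dim A_0'$), $$\delta_{\mathrm{pre}}(\Phi_1\|\Phi_2)=\sup_{\xi\in\mathfrak S(A_0'R)}\ \inf_{\substack{\sigma\in\mathfrak S(A_0R)\\ \sigma_R=\xi_R}}\ \|(\Phi_1\otimes \mathrm{id}_R)(\sigma)-(\Phi_2\otimes \mathrm{id}_R)(\xi)\|_1 .$$ 2. For every system $R$ with $\dim R\ge\dim A_0'$, the following are equivalent: (a) $\delta_{\mathrm{pre}}(\Phi_1\|\Phi_2)=0$; (b) $\Phi_2=\Phi_1\circ\Lambda$ for some channel $\Lambda\in\mathcal C(A_0',A_0)$; (c) $\mathcal R(\Phi_2\otimes \mathrm{id}_R)\subseteq\mathcal R(\Phi_1\otimes \mathrm{id}_R)$. -/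

import Mathlib

/-!
Finite-dimensional quantum systems are represented by finite index types: the system `A` has the
Hilbert space `ℂ^A` with its standard basis, `B(A)` is `Matrix A A ℂ`, and the composite system
`AB` is indexed by `A × B`.
-/

namespace QuantumComparison

open scoped ComplexOrder

/-- The set of states (density matrices) of the system `A`. -/
def states (A : Type*) [Fintype A] : Set (Matrix A A ℂ) :=
  {ρ | ρ.PosSemidef ∧ ρ.trace = 1}

/-- The map `Φ ⊗ id_R`, where `X` on `AR` is regarded as the block matrix with the `(r, r')` block
`(X (a, r) (a', r'))_{a, a'}`, and `Φ` is applied to every block. -/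
def tensorId {A B : Type*} (Φ : Matrix A A ℂ →ₗ[ℂ] Matrix B B ℂ) (R : Type*) :
    Matrix (A × R) (A × R) ℂ →ₗ[ℂ] Matrix (B × R) (B × R) ℂ where
  toFun X := Matrix.of fun x y => Φ (Matrix.of fun a a' => X (a, x.2) (a', y.2)) x.1 y.1
  map_add' X Y := by
    ext x y
    exact congrFun (congrFun (map_add Φ (Matrix.of fun a a' => X (a, x.2) (a', y.2))
      (Matrix.of fun a a' => Y (a, x.2) (a', y.2))) x.1) y.1
  map_smul' c X := by
    ext x y
    exact congrFun (congrFun (map_smul Φ c (Matrix.of fun a a' => X (a, x.2) (a', y.2))) x.1) y.1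

/-- `Φ ⊗ id_R` is determined by its values `Φ(X) ⊗ Y` on product operators `X ⊗ Y`. -/
theorem tensorId_kronecker {A B R : Type*} (Φ : Matrix A A ℂ →ₗ[ℂ] Matrix B B ℂ)
    (X : Matrix A A ℂ) (Y : Matrix R R ℂ) :
    tensorId Φ R (Matrix.kroneckerMap (· * ·) X Y) = Matrix.kroneckerMap (· * ·) (Φ X) Y := by
  ext x y
  have h : (Matrix.of fun a a' => Matrix.kroneckerMap (· * ·) X Y (a, x.2) (a', y.2)) =
      Y x.2 y.2 • X := by
    ext a a'
    simp [mul_comm]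
  have h2 := congrFun (congrFun (congrArg Φ h) x.1) y.1
  rw [map_smul] at h2
  exact h2.trans (mul_comm _ _)

/-- Quantum channels: completely positive and trace preserving linear maps `B(A) → B(B)`. -/
structure IsChannel {A B : Type*} [Fintype A] [Fintype B]
    (Φ : Matrix A A ℂ →ₗ[ℂ] Matrix B B ℂ) : Prop where
  completely_positive : ∀ (n : ℕ) (X : Matrix (A × Fin n) (A × Fin n) ℂ),
    X.PosSemidef → (tensorId Φ (Fin n) X).PosSemidef
  trace_preserving : ∀ X : Matrix A A ℂ, (Φ X).trace = X.trace

/-- The reduced operator `X_R = Tr_A X` of an operator `X` on `AR`. -/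
def reduceRight {A R : Type*} [Fintype A] (X : Matrix (A × R) (A × R) ℂ) : Matrix R R ℂ :=
  Matrix.of fun r r' => ∑ a, X (a, r) (a, r')

open scoped MatrixOrder in
/-- The trace norm `‖X‖₁ = Tr |X|`, with `|X| = (X* X)^{1/2}`. -/
noncomputable def traceNorm {A : Type*} [Fintype A] [DecidableEq A] (X : Matrix A A ℂ) : ℝ :=
  (CFC.abs X).trace.re

/-- The diamond norm `‖Φ‖_⋄`: the supremum of `‖(Φ ⊗ id_A)(ρ)‖₁` over the states `ρ` of `AA`. -/
noncomputable def diamondNorm {A B : Type*} [Fintype A] [DecidableEq A] [Fintype B]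
    [DecidableEq B] (Φ : Matrix A A ℂ →ₗ[ℂ] Matrix B B ℂ) : ℝ :=
  ⨆ ρ : states (A × A), traceNorm (tensorId Φ A ρ)

/-- The preprocessing deficiency `δ_pre(Φ₁‖Φ₂)`: the infimum of `‖Φ₁ ∘ Λ - Φ₂‖_⋄` over all
channels `Λ` from `A₀'` to `A₀`. -/
noncomputable def preDeficiency {A₀ A₀' A₁ : Type*} [Fintype A₀] [Fintype A₀'] [DecidableEq A₀']
    [Fintype A₁] [DecidableEq A₁] (Φ₁ : Matrix A₀ A₀ ℂ →ₗ[ℂ] Matrix A₁ A₁ ℂ)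
    (Φ₂ : Matrix A₀' A₀' ℂ →ₗ[ℂ] Matrix A₁ A₁ ℂ) : ℝ :=
  ⨅ Λ : {Λ : Matrix A₀' A₀' ℂ →ₗ[ℂ] Matrix A₀ A₀ ℂ // IsChannel Λ},
    diamondNorm (Φ₁ ∘ₗ Λ.1 - Φ₂)

/-- The range of a linear map `Φ` on operators: the set of images of the states under `Φ`. -/
def channelRange {A B : Type*} [Fintype A] (Φ : Matrix A A ℂ →ₗ[ℂ] Matrix B B ℂ) :
    Set (Matrix B B ℂ) :=
  Φ '' states A

end QuantumComparison

/-! Through Choi matrices the deficiency becomes the value of a bilinear game. Channels `Λ`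
correspond to `J ≥ 0` with `Tr_A J = 1`, and `Φ₁ ∘ Λ - Φ₂` has Choi matrix `(Φ₁ ⊗ id)(J) - choi Φ₂`,
affine in `J`. The opponent plays a state `ρ` and an operator `W` with `-1 ⊗ ρ ≤ W ≤ 1 ⊗ ρ`. The
payoff is the real trace pairing of `W` with that Choi matrix. Both strategy sets are compact and
convex, so Sion's theorem gives a saddle point (`exists_saddlePoint`).

The game is tied to norms from two sides. A test state `ω` and an optimal `-1 ≤ M ≤ 1` for the trace
norm pull back to a pair `(ρ, W)`, so the diamond norm is at most the best payoff
(`diamondNorm_le_of_dual`). Conversely, an invertible `ρ = V* V` yields a pure state `ξ` of full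
Schmidt rank, against which `W` becomes such an `M`. Moreover every `σ` with the same marginal as
`ξ` is `(Λ ⊗ id)(ξ)` for some channel `Λ`, so the inner infimum at `ξ` really ranges over channels.
A singular `ρ` is mixed with the maximally mixed state at the cost of a factor `1 - t`, and `t → 0`
closes the gap (`exists_pureState_payoff_le`).

For the range criterion, a preimage of the maximally entangled output of `Φ₂` is, up to scaling, the
Choi matrix of the required channel. -/

namespace QuantumComparison

open scoped ComplexOrder MatrixOrder Kronecker
open Matrix

/-! ### Choi matrices and entangled inputs -/

section Choi

variable {A B n R : Type*}

/-- The Choi matrix of a linear map on matrices. -/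
def choi [DecidableEq n] (Ψ : Matrix n n ℂ →ₗ[ℂ] Matrix B B ℂ) : Matrix (B × n) (B × n) ℂ :=
  Matrix.of fun x y => Ψ (Matrix.single x.2 y.2 1) x.1 y.1

/-- The linear map with a given Choi matrix. -/
def ofChoi [Fintype n] (J : Matrix (A × n) (A × n) ℂ) : Matrix n n ℂ →ₗ[ℂ] Matrix A A ℂ where
  toFun X := Matrix.of fun a a' => ∑ i, ∑ j, X i j * J (a, i) (a', j)
  map_add' X Y := by
    ext a a'
    simp [add_mul, Finset.sum_add_distrib]
  map_smul' c X := by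
    ext a a'
    simp [Finset.mul_sum, mul_assoc]

theorem ofChoi_apply [Fintype n] (J : Matrix (A × n) (A × n) ℂ) (X : Matrix n n ℂ) (a a' : A) :
    ofChoi J X a a' = ∑ i, ∑ j, X i j * J (a, i) (a', j) := rfl

theorem ofChoi_choi [Fintype n] [DecidableEq n] (Ψ : Matrix n n ℂ →ₗ[ℂ] Matrix B B ℂ) :
    ofChoi (choi Ψ) = Ψ := by
  refine LinearMap.ext fun X => ?_
  ext b b'
  conv_rhs => rw [matrix_eq_sum_single X]
  simp only [ofChoi_apply, choi, of_apply, map_sum, Matrix.sum_apply]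
  refine Finset.sum_congr rfl fun i _ => Finset.sum_congr rfl fun j _ => ?_
  have : single i j (X i j) = X i j • single i j (1 : ℂ) := by simp
  rw [this, map_smul]
  rfl

theorem ofChoi_single [Fintype n] [DecidableEq n] (J : Matrix (A × n) (A × n) ℂ) (i j : n) :
    ofChoi J (single i j 1) = Matrix.of fun a a' => J (a, i) (a', j) := by
  ext a a'
  rw [ofChoi_apply, Finset.sum_eq_single i, Finset.sum_eq_single j]
  · simp
  · intro j' _ h
    simp [single, h.symm]
  · simp
  · intro i' _ h
    simp [single, h.symm]
  · simp

theorem tensorId_apply (Φ : Matrix A A ℂ →ₗ[ℂ] Matrix B B ℂ) (X : Matrix (A × R) (A × R) ℂ)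
    (x y : B × R) :
    tensorId Φ R X x y = Φ (Matrix.of fun a a' => X (a, x.2) (a', y.2)) x.1 y.1 := rfl

/-- This makes the Choi matrix of `Φ ∘ Λ` linear in that of `Λ`, hence the payoff of the game affine
in `J`. -/
theorem choi_comp_ofChoi [Fintype n] [DecidableEq n] (Φ : Matrix A A ℂ →ₗ[ℂ] Matrix B B ℂ)
    (J : Matrix (A × n) (A × n) ℂ) : choi (Φ ∘ₗ ofChoi J) = tensorId Φ n J := by
  ext x y
  simp only [choi, of_apply, LinearMap.comp_apply, ofChoi_single, tensorId_apply]

theorem choi_sub [DecidableEq n] (Ψ Ψ' : Matrix n n ℂ →ₗ[ℂ] Matrix B B ℂ) :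
    choi (Ψ - Ψ') = choi Ψ - choi Ψ' := rfl

theorem tensorId_comp (Φ : Matrix A A ℂ →ₗ[ℂ] Matrix B B ℂ) (Λ : Matrix n n ℂ →ₗ[ℂ] Matrix A A ℂ)
    (X : Matrix (n × R) (n × R) ℂ) :
    tensorId (Φ ∘ₗ Λ) R X = tensorId Φ R (tensorId Λ R X) := rfl

theorem tensorId_sub (Φ Ψ : Matrix A A ℂ →ₗ[ℂ] Matrix B B ℂ) (X : Matrix (A × R) (A × R) ℂ) :
    tensorId (Φ - Ψ) R X = tensorId Φ R X - tensorId Ψ R X := rfl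

theorem tensorId_submatrix {S : Type*} (Φ : Matrix A A ℂ →ₗ[ℂ] Matrix B B ℂ)
    (X : Matrix (A × R) (A × R) ℂ) (f : S → R) :
    tensorId Φ S (X.submatrix (Prod.map id f) (Prod.map id f)) =
      (tensorId Φ R X).submatrix (Prod.map id f) (Prod.map id f) := rfl

theorem tensorId_eq_sum_choi [Fintype n] [DecidableEq n] (Ψ : Matrix n n ℂ →ₗ[ℂ] Matrix B B ℂ)
    (X : Matrix (n × R) (n × R) ℂ) (x y : B × R) :
    tensorId Ψ R X x y = ∑ i, ∑ j, X (i, x.2) (j, y.2) * choi Ψ (x.1, i) (y.1, j) := by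
  conv_lhs => rw [← ofChoi_choi Ψ]
  rfl

/-- The unnormalised vector `∑ i, |i, f i⟩` as a rank one matrix. -/
def entangled [DecidableEq R] (f : n → R) : Matrix (n × R) (n × R) ℂ :=
  vecMulVec (fun x => if f x.1 = x.2 then 1 else 0) (star fun x => if f x.1 = x.2 then 1 else 0)

theorem posSemidef_entangled [Finite n] [Finite R] [DecidableEq R] (f : n → R) :
    (entangled f).PosSemidef :=
  posSemidef_vecMulVec_self_star _

theorem entangled_apply [DecidableEq R] (f : n → R) (x y : n × R) :
    entangled f x y = if f x.1 = x.2 ∧ f y.1 = y.2 then 1 else 0 := by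
  simp only [entangled, vecMulVec_apply, Pi.star_apply]
  split_ifs <;> simp_all

/-- The embedding `f` lets the ancilla be larger than the input: the block supported on the image of
`f` already contains all of `choi Ψ`. -/
theorem tensorId_entangled_submatrix [DecidableEq n] [DecidableEq R]
    (Ψ : Matrix n n ℂ →ₗ[ℂ] Matrix B B ℂ) {f : n → R} (hf : Function.Injective f) :
    (tensorId Ψ R (entangled f)).submatrix (Prod.map id f) (Prod.map id f) = choi Ψ := by
  ext x y
  simp only [choi, submatrix_apply, tensorId_apply, of_apply, Prod.map_fst, Prod.map_snd, id]
  refine congrFun (congrFun (congrArg Ψ ?_) _) _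
  ext i j
  simp [entangled_apply, hf.eq_iff, single_apply, eq_comm]

theorem tensorId_entangled_id [DecidableEq n] (Ψ : Matrix n n ℂ →ₗ[ℂ] Matrix B B ℂ) :
    tensorId Ψ n (entangled id) = choi Ψ :=
  tensorId_entangled_submatrix Ψ Function.injective_id

theorem trace_reduceRight [Fintype A] [Fintype R] (X : Matrix (A × R) (A × R) ℂ) :
    (reduceRight X).trace = X.trace := by
  simp only [trace, diag, reduceRight, of_apply, Fintype.sum_prod_type]
  exact Finset.sum_comm

theorem reduceRight_tensorId [Fintype A] [Fintype B] {Φ : Matrix A A ℂ →ₗ[ℂ] Matrix B B ℂ}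
    (h : ∀ X : Matrix A A ℂ, (Φ X).trace = X.trace) (X : Matrix (A × R) (A × R) ℂ) :
    reduceRight (tensorId Φ R X) = reduceRight X := by
  ext r r'
  exact h (Matrix.of fun a a' => X (a, r) (a', r'))

end Choi

/-! ### Positivity, Choi's theorem and entrywise bounds -/

section Positivity

variable {A B n R : Type*} [Fintype A] [Fintype B] [Fintype n] [Fintype R]

/-- Compressing a positive semidefinite block matrix by summing over all blocks. -/
theorem posSemidef_sum_blocks {γ κ : Type*} [Fintype γ] [Fintype κ]
    {P : Matrix (γ × κ) (γ × κ) ℂ} (hP : P.PosSemidef) :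
    (Matrix.of fun x y => ∑ k, ∑ l, P (x, k) (y, l) : Matrix γ γ ℂ).PosSemidef := by
  classical
  have h := hP.conjTranspose_mul_mul_same
    (Matrix.of fun (x : γ × κ) (y : γ) => if x.1 = y then (1 : ℂ) else 0)
  convert h using 1
  ext x y
  simp only [of_apply, mul_apply, conjTranspose_apply, Fintype.sum_prod_type_right, apply_ite star,
    star_one, star_zero, ite_mul, one_mul, zero_mul, mul_ite, mul_one, mul_zero,
    Finset.sum_ite_eq', Finset.mem_univ, if_true]
  exact Finset.sum_comm

theorem norm_apply_le_trace {X : Matrix n n ℂ} (hX : X.PosSemidef) (i j : n) :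
    ‖X i j‖ ≤ X.trace.re := by
  classical
  have hd : ∀ k, 0 ≤ (X k k).re ∧ (X k k).im = 0 := fun k => by
    have := Complex.le_def.1 (hX.diag_nonneg (i := k))
    exact ⟨this.1, this.2.symm⟩
  have hle : ∀ k, (X k k).re ≤ X.trace.re := fun k => by
    rw [trace, Complex.re_sum]
    exact Finset.single_le_sum (f := fun k => (X k k).re) (fun k _ => (hd k).1) (Finset.mem_univ k)
  -- The minor on `i, j` gives `|X i j|² ≤ X i i * X j j`; for `i = j` the repeated index is
  -- harmless.
  have hdet := (hX.submatrix ![i, j]).det_nonneg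
  rw [det_fin_two] at hdet
  simp only [submatrix_apply, cons_val_zero, cons_val_one] at hdet
  have hji : X j i = star (X i j) := (hX.isHermitian.apply j i).symm
  rw [hji, Complex.star_def, Complex.mul_conj] at hdet
  have h2 := (Complex.le_def.1 hdet).1
  simp only [Complex.sub_re, Complex.mul_re, (hd i).2, (hd j).2, Complex.ofReal_re,
    Complex.zero_re, Complex.normSq_eq_norm_sq] at h2
  have h3 := mul_le_mul (hle i) (hle j) (hd j).1 ((hd i).1.trans (hle i))
  refine abs_le_of_sq_le_sq' ?_ ((hd i).1.trans (hle i)) |>.2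
  nlinarith

theorem isClosed_posSemidef : IsClosed {X : Matrix n n ℂ | X.PosSemidef} := by
  simp only [posSemidef_iff_dotProduct_mulVec, Set.ofPred_and, IsHermitian, Set.ofPred_forall]
  refine (isClosed_eq (by fun_prop) continuous_id).inter (isClosed_iInter fun x => ?_)
  exact isClosed_le continuous_const (by fun_prop)

theorem isCompact_of_norm_apply_le {m k : Type*} {S : Set (Matrix m k ℂ)}
    (hS : IsClosed S) (c : ℝ) (hc : ∀ X ∈ S, ∀ i j, ‖X i j‖ ≤ c) : IsCompact S := by
  have : IsCompact (Set.pi Set.univ fun _ : m => Set.pi Set.univ fun _ : k =>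
      Metric.closedBall (0 : ℂ) c) :=
    isCompact_univ_pi fun _ => isCompact_univ_pi fun _ => isCompact_closedBall _ _
  refine IsCompact.of_isClosed_subset this hS fun X hX i _ j _ => ?_
  simpa using hc X hX i j

theorem trace_mul_nonneg {X Y : Matrix n n ℂ} (hX : X.PosSemidef) (hY : Y.PosSemidef) :
    0 ≤ (X * Y).trace := by
  classical
  obtain ⟨Z, rfl⟩ := CStarAlgebra.nonneg_iff_eq_star_mul_self.mp hX.nonneg
  rw [mul_assoc, trace_mul_comm]
  exact (hY.mul_mul_conjTranspose_same Z).trace_nonneg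

/-- The output is a compression of `X ⊗ J`: keep equal `n`-indices in the two factors, then sum over
the row index and the column index independently. -/
theorem posSemidef_tensorId_ofChoi {J : Matrix (A × n) (A × n) ℂ} (hJ : J.PosSemidef)
    {X : Matrix (n × R) (n × R) ℂ} (hX : X.PosSemidef) :
    (tensorId (ofChoi J) R X).PosSemidef := by
  have h := (hX.kronecker hJ).submatrix
    (fun p : (A × R) × n => ((p.2, p.1.2), (p.1.1, p.2)))
  convert posSemidef_sum_blocks h using 1
  ext x y
  simp only [tensorId_apply, ofChoi_apply, of_apply, submatrix_apply, kroneckerMap_apply]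

theorem isChannel_ofChoi [DecidableEq n] {J : Matrix (A × n) (A × n) ℂ} (hJ : J.PosSemidef)
    (h1 : reduceRight J = 1) : IsChannel (ofChoi J) where
  completely_positive _ _ hX := posSemidef_tensorId_ofChoi hJ hX
  trace_preserving X := by
    have h : ∀ i j, ∑ a, J (a, i) (a, j) = (1 : Matrix n n ℂ) i j := fun i j => by
      rw [← h1]; rfl
    simp only [trace, diag, ofChoi_apply]
    rw [Finset.sum_comm]
    refine Finset.sum_congr rfl fun i _ => ?_
    rw [Finset.sum_comm]
    simp [← Finset.mul_sum, h, one_apply]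

theorem IsChannel.tensorId_posSemidef {Φ : Matrix A A ℂ →ₗ[ℂ] Matrix B B ℂ} (h : IsChannel Φ)
    {X : Matrix (A × R) (A × R) ℂ} (hX : X.PosSemidef) : (tensorId Φ R X).PosSemidef := by
  have e := Fintype.equivFin R
  have h1 := h.completely_positive _ _ (hX.submatrix (Prod.map id e.symm))
  rw [tensorId_submatrix] at h1
  have h2 := h1.submatrix (Prod.map id e)
  rw [submatrix_submatrix] at h2
  have h3 : (Prod.map id e.symm ∘ Prod.map id e : B × R → B × R) = id := by
    ext x <;> simp
  rwa [h3] at h2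

theorem IsChannel.tensorId_mem_states {Φ : Matrix A A ℂ →ₗ[ℂ] Matrix B B ℂ} (h : IsChannel Φ)
    {X : Matrix (A × R) (A × R) ℂ} (hX : X ∈ states (A × R)) :
    tensorId Φ R X ∈ states (B × R) := by
  refine ⟨h.tensorId_posSemidef hX.1, ?_⟩
  rw [← trace_reduceRight, reduceRight_tensorId h.trace_preserving, trace_reduceRight, hX.2]

theorem IsChannel.choi_posSemidef [DecidableEq n] {Λ : Matrix n n ℂ →ₗ[ℂ] Matrix A A ℂ}
    (h : IsChannel Λ) : (choi Λ).PosSemidef := by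
  rw [← tensorId_entangled_id]
  exact h.tensorId_posSemidef (posSemidef_entangled _)

theorem IsChannel.reduceRight_choi [DecidableEq n] {Λ : Matrix n n ℂ →ₗ[ℂ] Matrix A A ℂ}
    (h : IsChannel Λ) : reduceRight (choi Λ) = 1 := by
  ext i j
  refine (h.trace_preserving (single i j 1)).trans ?_
  by_cases hij : i = j
  · subst hij; simp
  · simp [hij, trace_single_eq_of_ne]

theorem IsChannel.comp {C : Type*} [Fintype C] {Φ : Matrix A A ℂ →ₗ[ℂ] Matrix B B ℂ}
    {Λ : Matrix C C ℂ →ₗ[ℂ] Matrix A A ℂ} (h : IsChannel Φ) (h' : IsChannel Λ) :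
    IsChannel (Φ ∘ₗ Λ) where
  completely_positive n X hX := h.completely_positive n _ (h'.completely_positive n X hX)
  trace_preserving X := (h.trace_preserving _).trans (h'.trace_preserving X)

end Positivity

/-! ### Trace norm by duality -/

section TraceNorm

variable {n : Type*} [Fintype n] [DecidableEq n]

theorem traceNorm_nonneg (X : Matrix n n ℂ) : 0 ≤ traceNorm X :=
  (Complex.le_def.1 (nonneg_iff_posSemidef.1 (CFC.abs_nonneg X)).trace_nonneg).1

theorem eq_zero_of_traceNorm_eq_zero {X : Matrix n n ℂ} (h : traceNorm X = 0) : X = 0 := by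
  have hp := nonneg_iff_posSemidef.1 (CFC.abs_nonneg X)
  have h0 := Complex.le_def.1 hp.trace_nonneg
  have ht : (CFC.abs X).trace = 0 := Complex.ext h h0.2.symm
  have ha := hp.trace_eq_zero_iff.1 ht
  have := CFC.abs_mul_abs X
  rw [ha, mul_zero, star_eq_conjTranspose] at this
  exact conjTranspose_mul_self_eq_zero.1 this.symm

/-- Split `X = X⁺ - X⁻`. Then `Tr M X⁺ ≤ Tr X⁺` and `-Tr M X⁻ ≤ Tr X⁻`, and the right-hand sides add
up to `Tr |X|`. -/
theorem re_trace_mul_le_traceNorm {X M : Matrix n n ℂ} (hX : X.IsHermitian)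
    (h1 : (1 - M).PosSemidef) (h2 : (1 + M).PosSemidef) : (M * X).trace.re ≤ traceNorm X := by
  have hX' : IsSelfAdjoint X := hX
  have hp := trace_mul_nonneg h1 (nonneg_iff_posSemidef.1 (CFC.posPart_nonneg X))
  have hq := trace_mul_nonneg h2 (nonneg_iff_posSemidef.1 (CFC.negPart_nonneg X))
  have e : M * X = M * X⁺ - M * X⁻ := by rw [← mul_sub, CFC.posPart_sub_negPart X hX']
  rw [traceNorm, ← CFC.posPart_add_negPart X hX', e]
  simp only [sub_mul, add_mul, one_mul, trace_sub, trace_add] at hp hq ⊢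
  have hp := (Complex.le_def.1 hp).1
  have hq := (Complex.le_def.1 hq).1
  simp only [Complex.sub_re, Complex.add_re, Complex.zero_re] at *
  linarith

theorem exists_re_trace_mul_eq_traceNorm {X : Matrix n n ℂ} (hX : X.IsHermitian) :
    ∃ M : Matrix n n ℂ, (1 - M).PosSemidef ∧ (1 + M).PosSemidef ∧
      (M * X).trace.re = traceNorm X := by
  have hX' : IsSelfAdjoint X := hX
  -- The spectrum is finite, so the functional calculus accepts the discontinuous sign function,
  -- which supplies the optimal `M`.
  have hc : ∀ f : ℝ → ℝ, ContinuousOn f (spectrum ℝ X) := fun f =>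
    (finite_real_spectrum (A := X)).continuousOn f
  let s : ℝ → ℝ := fun x => if 0 ≤ x then 1 else -1
  refine ⟨cfc s X, ?_, ?_, ?_⟩
  · rw [← nonneg_iff_posSemidef, ← cfc_one ℝ X, ← cfc_sub _ _ X (hc _) (hc _)]
    refine cfc_nonneg fun x _ => ?_
    by_cases h : 0 ≤ x <;> simp [s, h]
  · rw [← nonneg_iff_posSemidef, ← cfc_one ℝ X, ← cfc_add _ _ _ (hc _) (hc _)]
    refine cfc_nonneg fun x _ => ?_
    by_cases h : 0 ≤ x <;> simp [s, h]
  · have e : cfc s X * X = CFC.abs X := by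
      have : cfc s X * X = cfc s X * cfc (fun x : ℝ => x) X := by rw [cfc_id' ℝ X]
      rw [this, ← cfc_mul _ _ X (hc _) (hc _), CFC.abs_eq_cfc_norm X hX']
      refine cfc_congr fun x _ => ?_
      by_cases h : 0 ≤ x
      · simp [s, h, abs_of_nonneg h]
      · simp [s, h, abs_of_neg (not_le.1 h)]
    rw [e, traceNorm]

theorem traceNorm_sub_le {X Y : Matrix n n ℂ} (hX : X.PosSemidef) (hY : Y.PosSemidef) :
    traceNorm (X - Y) ≤ X.trace.re + Y.trace.re := by
  obtain ⟨M, h1, h2, h3⟩ := exists_re_trace_mul_eq_traceNorm (hX.isHermitian.sub hY.isHermitian)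
  have hp := (Complex.le_def.1 (trace_mul_nonneg h1 hX)).1
  have hq := (Complex.le_def.1 (trace_mul_nonneg h2 hY)).1
  rw [← h3]
  simp only [sub_mul, add_mul, mul_sub, one_mul, trace_sub, trace_add, Complex.sub_re,
    Complex.add_re, Complex.zero_re] at *
  linarith

omit [DecidableEq n] in
theorem trace_submatrix_equiv {m : Type*} [Fintype m] (X : Matrix n n ℂ) (e : m ≃ n) :
    (X.submatrix e e).trace = X.trace :=
  Equiv.sum_comp e fun i => X i i

theorem traceNorm_submatrix_equiv {m : Type*} [Fintype m] [DecidableEq m] {X : Matrix n n ℂ}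
    (hX : X.IsHermitian) (e : m ≃ n) : traceNorm (X.submatrix e e) = traceNorm X := by
  apply le_antisymm
  · obtain ⟨M, h1, h2, h3⟩ := exists_re_trace_mul_eq_traceNorm (hX.submatrix e)
    have h1' := h1.submatrix e.symm
    have h2' := h2.submatrix e.symm
    rw [submatrix_sub, Pi.sub_apply, Pi.sub_apply, submatrix_one_equiv] at h1'
    rw [submatrix_add, Pi.add_apply, Pi.add_apply, submatrix_one_equiv] at h2'
    rw [← h3]
    refine le_trans (le_of_eq ?_) (re_trace_mul_le_traceNorm hX h1' h2')
    have : (M * X.submatrix e e) = (M.submatrix e.symm e.symm * X).submatrix e e := by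
      rw [← submatrix_mul_equiv _ _ _ e]; simp
    rw [this, trace_submatrix_equiv]
  · obtain ⟨M, h1, h2, h3⟩ := exists_re_trace_mul_eq_traceNorm hX
    have h1' := h1.submatrix e
    have h2' := h2.submatrix e
    rw [submatrix_sub, Pi.sub_apply, Pi.sub_apply, submatrix_one_equiv] at h1'
    rw [submatrix_add, Pi.add_apply, Pi.add_apply, submatrix_one_equiv] at h2'
    rw [← h3]
    refine le_trans (le_of_eq ?_) (re_trace_mul_le_traceNorm (hX.submatrix e) h1' h2')
    rw [submatrix_mul_equiv, trace_submatrix_equiv]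

end TraceNorm

/-! ### Moving a test operator and a test state onto the Choi matrix -/

section Pullback

variable {A B n R : Type*} [Fintype A] [Fintype B] [Fintype n] [Fintype R]

omit [Fintype A] in
theorem choi_ofChoi [DecidableEq n] (J : Matrix (A × n) (A × n) ℂ) : choi (ofChoi J) = J := by
  ext x y
  simp only [choi, of_apply, ofChoi_single]

/-- The operator representing `Ψ ↦ Tr (M (Ψ ⊗ id)(ω))` on Choi matrices. -/
def pullback (M : Matrix (B × R) (B × R) ℂ) (ω : Matrix (n × R) (n × R) ℂ) :
    Matrix (B × n) (B × n) ℂ :=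
  Matrix.of fun x y => ∑ s, ∑ r, M (x.1, s) (y.1, r) * ω (y.2, r) (x.2, s)

theorem trace_mul_tensorId [DecidableEq n] (Ψ : Matrix n n ℂ →ₗ[ℂ] Matrix B B ℂ)
    (M : Matrix (B × R) (B × R) ℂ) (ω : Matrix (n × R) (n × R) ℂ) :
    (M * tensorId Ψ R ω).trace = (pullback M ω * choi Ψ).trace := by
  have l : (M * tensorId Ψ R ω).trace = ∑ b', ∑ s, ∑ b, ∑ r, ∑ i, ∑ j,
      M (b', s) (b, r) * (ω (i, r) (j, s) * choi Ψ (b, i) (b', j)) := by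
    simp only [trace, diag, mul_apply, Fintype.sum_prod_type, tensorId_eq_sum_choi, Finset.mul_sum]
  have r : (pullback M ω * choi Ψ).trace = ∑ b', ∑ j, ∑ b, ∑ i, ∑ s, ∑ r,
      M (b', s) (b, r) * (ω (i, r) (j, s) * choi Ψ (b, i) (b', j)) := by
    simp only [trace, diag, mul_apply, Fintype.sum_prod_type, pullback, of_apply, Finset.sum_mul,
      mul_assoc]
  rw [l, r]
  refine Finset.sum_congr rfl fun b' _ => ?_
  -- Both sides are the same sixfold sum; `e` only permutes the order of summation.
  let e : R × B × R × n × n ≃ n × B × n × R × R :=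
    { toFun := fun p => (p.2.2.2.2, p.2.1, p.2.2.2.1, p.1, p.2.2.1)
      invFun := fun q => (q.2.2.2.1, q.2.1, q.2.2.2.2, q.2.2.1, q.1)
      left_inv := fun _ => rfl
      right_inv := fun _ => rfl }
  have h := Fintype.sum_equiv e
    (fun p => M (b', p.1) (p.2.1, p.2.2.1) *
      (ω (p.2.2.2.1, p.2.2.1) (p.2.2.2.2, p.1) * choi Ψ (p.2.1, p.2.2.2.1) (b', p.2.2.2.2)))
    (fun q => M (b', q.2.2.2.1) (q.2.1, q.2.2.2.2) *
      (ω (q.2.2.1, q.2.2.2.2) (q.1, q.2.2.2.1) * choi Ψ (q.2.1, q.2.2.1) (b', q.1)))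
    fun _ => rfl
  simpa only [Fintype.sum_prod_type] using h

/-- The pullback contracts `M ⊗ ωᵀ` along the ancilla, a compression of a positive operator. With
`pullback_one`, it turns `-1 ≤ M ≤ 1` into `-1 ⊗ ρ ≤ W ≤ 1 ⊗ ρ`, where `ρ` is the transposed
marginal of `ω`. -/
theorem posSemidef_pullback {M : Matrix (B × R) (B × R) ℂ} {ω : Matrix (n × R) (n × R) ℂ}
    (hM : M.PosSemidef) (hω : ω.PosSemidef) : (pullback M ω).PosSemidef := by
  have h := (hM.kronecker hω.transpose).submatrix
    (fun p : (B × n) × R => ((p.1.1, p.2), (p.1.2, p.2)))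
  convert posSemidef_sum_blocks h using 1
  ext x y
  simp only [pullback, of_apply, submatrix_apply, kroneckerMap_apply, transpose_apply]

omit [Fintype B] [Fintype n] in
theorem pullback_add (M N : Matrix (B × R) (B × R) ℂ) (ω : Matrix (n × R) (n × R) ℂ) :
    pullback (M + N) ω = pullback M ω + pullback N ω := by
  ext x y
  simp [pullback, add_mul, Finset.sum_add_distrib]

omit [Fintype B] [Fintype n] in
theorem pullback_sub (M N : Matrix (B × R) (B × R) ℂ) (ω : Matrix (n × R) (n × R) ℂ) :
    pullback (M - N) ω = pullback M ω - pullback N ω := by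
  ext x y
  simp [pullback, sub_mul, Finset.sum_sub_distrib]

omit [Fintype B] [Fintype n] in
theorem pullback_one [DecidableEq B] [DecidableEq R] (ω : Matrix (n × R) (n × R) ℂ) :
    pullback (1 : Matrix (B × R) (B × R) ℂ) ω =
      (1 : Matrix B B ℂ) ⊗ₖ (reduceRight (ω.submatrix Prod.swap Prod.swap))ᵀ := by
  ext x y
  by_cases h : x.1 = y.1 <;> simp [pullback, one_apply, Prod.ext_iff, reduceRight, h]

omit [Fintype R] in
theorem posSemidef_reduceRight {X : Matrix (A × R) (A × R) ℂ} (hX : X.PosSemidef) :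
    (reduceRight X).PosSemidef := by
  classical
  have : reduceRight X = ∑ a, X.submatrix (fun r => (a, r)) (fun r => (a, r)) := by
    ext r r'
    simp [reduceRight, Matrix.sum_apply]
  rw [this]
  exact posSemidef_sum _ fun a _ => hX.submatrix _

theorem reduceRight_transpose_mem_states {ω : Matrix (n × R) (n × R) ℂ} (hω : ω ∈ states (n × R)) :
    (reduceRight (ω.submatrix Prod.swap Prod.swap))ᵀ ∈ states n := by
  refine ⟨(posSemidef_reduceRight (hω.1.submatrix _)).transpose, ?_⟩
  classical
  rw [trace_transpose, trace_reduceRight, ← hω.2]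
  exact trace_submatrix_equiv ω (Equiv.prodComm R n)

end Pullback

/-! ### The strategy sets and the minimax theorem -/

section Dual

variable {A B n : Type*} [Fintype A] [Fintype B] [Fintype n]

/-- The pairs `(ρ, W)` of a state `ρ` and an operator `W` with `-1 ⊗ ρ ≤ W ≤ 1 ⊗ ρ`. The
operators `W` are the functionals on Choi matrices whose supremum is the diamond norm. -/
def dualSet (n B : Type*) [Fintype n] [DecidableEq B] :
    Set (Matrix n n ℂ × Matrix (B × n) (B × n) ℂ) :=
  {p | p.1 ∈ states n ∧ ((1 : Matrix B B ℂ) ⊗ₖ p.1 - p.2).PosSemidef ∧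
    ((1 : Matrix B B ℂ) ⊗ₖ p.1 + p.2).PosSemidef}

/-- The Choi matrices of channels. -/
def choiSet (n A : Type*) [DecidableEq n] [Fintype A] : Set (Matrix (A × n) (A × n) ℂ) :=
  {J | J.PosSemidef ∧ reduceRight J = 1}

theorem convex_states : Convex ℝ (states n) := by
  rintro ρ ⟨h1, h2⟩ σ ⟨h3, h4⟩ a b ha hb hab
  refine ⟨(h1.smul ha).add (h3.smul hb), ?_⟩
  rw [trace_add, trace_smul, trace_smul, h2, h4, ← add_smul, hab, one_smul]

theorem isClosed_states : IsClosed (states n) := by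
  rw [states, Set.ofPred_and]
  exact isClosed_posSemidef.inter (isClosed_eq (by fun_prop) continuous_const)

theorem isCompact_states : IsCompact (states n) := by
  refine isCompact_of_norm_apply_le isClosed_states 1 fun X hX i j => ?_
  have := norm_apply_le_trace hX.1 i j
  rwa [hX.2] at this

omit [Fintype B] in
theorem convex_dualSet [DecidableEq B] : Convex ℝ (dualSet n B) := by
  rintro p ⟨h1, h2, h3⟩ q ⟨h4, h5, h6⟩ a b ha hb hab
  refine ⟨convex_states h1 h4 ha hb hab, ?_, ?_⟩
  · convert (h2.smul ha).add (h5.smul hb) using 1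
    simp only [Prod.fst_add, Prod.snd_add, Prod.smul_fst, Prod.smul_snd, kronecker_add,
      kronecker_smul, smul_sub]
    abel
  · convert (h3.smul ha).add (h6.smul hb) using 1
    simp only [Prod.fst_add, Prod.snd_add, Prod.smul_fst, Prod.smul_snd, kronecker_add,
      kronecker_smul, smul_add]
    abel

omit [Fintype B] [Fintype n] in
theorem continuous_one_kronecker [DecidableEq B] :
    Continuous fun ρ : Matrix n n ℂ => (1 : Matrix B B ℂ) ⊗ₖ ρ := by
  refine continuous_matrix fun x y => ?_
  simp only [kroneckerMap_apply]
  fun_prop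

theorem isCompact_dualSet [DecidableEq B] : IsCompact (dualSet n B) := by
  have hc1 : Continuous fun p : Matrix n n ℂ × Matrix (B × n) (B × n) ℂ =>
      (1 : Matrix B B ℂ) ⊗ₖ p.1 := continuous_one_kronecker.comp continuous_fst
  have hcl : IsClosed (dualSet n B) :=
    (isClosed_states.preimage continuous_fst).inter
      ((isClosed_posSemidef.preimage (hc1.sub continuous_snd)).inter
        (isClosed_posSemidef.preimage (hc1.add continuous_snd)))
  have hball : IsCompact {W : Matrix (B × n) (B × n) ℂ | ∀ i j, ‖W i j‖ ≤ Fintype.card B} := by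
    refine isCompact_of_norm_apply_le ?_ (Fintype.card B : ℝ) fun W hW => hW
    simp only [Set.ofPred_forall]
    exact isClosed_iInter fun i => isClosed_iInter fun j =>
      isClosed_le (by fun_prop) continuous_const
  refine (isCompact_states.prod hball).of_isClosed_subset hcl ?_
  rintro ⟨ρ, W⟩ ⟨h1, h2, h3⟩
  refine ⟨h1, fun i j => ?_⟩
  change ((1 : Matrix B B ℂ) ⊗ₖ ρ - W).PosSemidef at h2
  change ((1 : Matrix B B ℂ) ⊗ₖ ρ + W).PosSemidef at h3
  have b1 := norm_apply_le_trace h2 i j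
  have b2 := norm_apply_le_trace h3 i j
  -- The positive operators `1 ⊗ ρ ± W` differ by `2 W` and their traces add up to `2 dim B`, so
  -- bounding entries by traces bounds `W`.
  have e : (2 : ℂ) * W i j =
      ((1 : Matrix B B ℂ) ⊗ₖ ρ + W) i j - ((1 : Matrix B B ℂ) ⊗ₖ ρ - W) i j := by
    rw [Matrix.add_apply, Matrix.sub_apply]; ring
  have b3 := norm_sub_le (((1 : Matrix B B ℂ) ⊗ₖ ρ + W) i j) (((1 : Matrix B B ℂ) ⊗ₖ ρ - W) i j)
  rw [← e, norm_mul, Complex.norm_ofNat] at b3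
  have t : ((1 : Matrix B B ℂ) ⊗ₖ ρ).trace.re = (Fintype.card B : ℝ) := by
    rw [trace_kronecker, h1.2]; simp
  simp only [trace_add, trace_sub, Complex.add_re, Complex.sub_re] at b1 b2 t
  rw [t] at b1 b2
  change ‖W i j‖ ≤ _
  linarith

theorem continuous_reduceRight {R : Type*} :
    Continuous fun X : Matrix (A × R) (A × R) ℂ => reduceRight X := by
  refine continuous_matrix fun x y => ?_
  simp only [reduceRight, of_apply]
  fun_prop

theorem reduceRight_add {R : Type*} (X Y : Matrix (A × R) (A × R) ℂ) :
    reduceRight (X + Y) = reduceRight X + reduceRight Y := by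
  ext r r'
  simp [reduceRight, Finset.sum_add_distrib]

theorem reduceRight_smul {R K : Type*} [DistribSMul K ℂ] (c : K) (X : Matrix (A × R) (A × R) ℂ) :
    reduceRight (c • X) = c • reduceRight X := by
  ext r r'
  simp [reduceRight, Finset.smul_sum]

omit [Fintype n] in
theorem convex_choiSet [DecidableEq n] : Convex ℝ (choiSet n A) := by
  rintro J ⟨h1, h2⟩ K ⟨h3, h4⟩ a b ha hb hab
  refine ⟨(h1.smul ha).add (h3.smul hb), ?_⟩
  rw [reduceRight_add, reduceRight_smul, reduceRight_smul, h2, h4, ← add_smul, hab, one_smul]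

theorem isCompact_choiSet [DecidableEq n] : IsCompact (choiSet n A) := by
  refine isCompact_of_norm_apply_le (isClosed_posSemidef.inter
    (isClosed_eq continuous_reduceRight continuous_const)) (Fintype.card n) fun J hJ i j => ?_
  have := norm_apply_le_trace hJ.1 i j
  rwa [← trace_reduceRight, hJ.2, trace_one, Complex.natCast_re] at this

omit [Fintype n] in
theorem choiSet_nonempty [DecidableEq n] [Nonempty A] : (choiSet n A).Nonempty := by
  classical
  refine ⟨(Fintype.card A : ℝ)⁻¹ • 1, PosSemidef.one.smul (by positivity), ?_⟩
  rw [reduceRight_smul]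
  ext r r'
  by_cases h : r = r' <;> simp [reduceRight, one_apply, h]

theorem trace_entangled {R : Type*} [Fintype R] [DecidableEq R] (f : n → R) :
    (entangled f).trace = Fintype.card n := by
  simp only [trace, diag, entangled_apply, and_self, Fintype.sum_prod_type]
  simp

theorem smul_entangled_mem_states {R : Type*} [Fintype R] [DecidableEq R] [Nonempty n]
    (f : n → R) : (Fintype.card n : ℝ)⁻¹ • entangled f ∈ states (n × R) := by
  refine ⟨(posSemidef_entangled f).smul (by positivity), ?_⟩
  rw [trace_smul, trace_entangled]
  simp

theorem states_nonempty [Nonempty n] : (states n).Nonempty := by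
  classical
  refine ⟨(Fintype.card n : ℝ)⁻¹ • 1, PosSemidef.one.smul (by positivity), ?_⟩
  rw [trace_smul, trace_one]
  simp

theorem dualSet_nonempty [DecidableEq B] [Nonempty n] : (dualSet n B).Nonempty := by
  obtain ⟨ρ, hρ⟩ := states_nonempty (n := n)
  have h : ((1 : Matrix B B ℂ) ⊗ₖ ρ).PosSemidef := PosSemidef.one.kronecker hρ.1
  exact ⟨(ρ, 0), hρ, by simpa using h, by simpa using h⟩

/-- The payoff of the bilinear game whose value is the preprocessing deficiency. -/
def payoff (Φ : Matrix A A ℂ →ₗ[ℂ] Matrix B B ℂ) (C : Matrix (B × n) (B × n) ℂ)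
    (J : Matrix (A × n) (A × n) ℂ) (W : Matrix (B × n) (B × n) ℂ) : ℝ :=
  (W * (tensorId Φ n J - C)).trace.re

omit [Fintype A] in
theorem payoff_eq [DecidableEq n] (Φ : Matrix A A ℂ →ₗ[ℂ] Matrix B B ℂ)
    (Φ' : Matrix n n ℂ →ₗ[ℂ] Matrix B B ℂ) (J : Matrix (A × n) (A × n) ℂ)
    (W : Matrix (B × n) (B × n) ℂ) :
    payoff Φ (choi Φ') J W = (W * choi (Φ ∘ₗ ofChoi J - Φ')).trace.re := by
  rw [payoff, choi_sub, choi_comp_ofChoi]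

omit [Fintype A] in
theorem payoff_smul_add_smul_left (Φ : Matrix A A ℂ →ₗ[ℂ] Matrix B B ℂ)
    (C W : Matrix (B × n) (B × n) ℂ) (J K : Matrix (A × n) (A × n) ℂ) {a b : ℝ} (hab : a + b = 1) :
    payoff Φ C (a • J + b • K) W = a • payoff Φ C J W + b • payoff Φ C K W := by
  have : tensorId Φ n (a • J + b • K) - C =
      a • (tensorId Φ n J - C) + b • (tensorId Φ n K - C) := by
    rw [map_add, LinearMap.map_smul_of_tower, LinearMap.map_smul_of_tower]
    conv_lhs => rw [← one_smul ℝ C, ← hab, add_smul]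
    rw [smul_sub, smul_sub]
    abel
  rw [payoff, this, mul_add, mul_smul_comm, mul_smul_comm, trace_add, trace_smul, trace_smul,
    Complex.add_re, Complex.smul_re, Complex.smul_re]
  rfl

omit [Fintype A] in
theorem payoff_smul_add_smul_right (Φ : Matrix A A ℂ →ₗ[ℂ] Matrix B B ℂ)
    (C W V : Matrix (B × n) (B × n) ℂ) (J : Matrix (A × n) (A × n) ℂ) (a b : ℝ) :
    payoff Φ C J (a • W + b • V) = a • payoff Φ C J W + b • payoff Φ C J V := by
  rw [payoff, add_mul, smul_mul_assoc, smul_mul_assoc, trace_add, trace_smul, trace_smul,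
    Complex.add_re, Complex.smul_re, Complex.smul_re]
  rfl

theorem continuous_payoff_left (Φ : Matrix A A ℂ →ₗ[ℂ] Matrix B B ℂ)
    (C W : Matrix (B × n) (B × n) ℂ) : Continuous fun J => payoff Φ C J W := by
  have hcont : Continuous (tensorId Φ n) := (tensorId Φ n).continuous_of_finiteDimensional
  exact Complex.continuous_re.comp
    (continuous_const.matrix_mul (hcont.sub continuous_const)).matrix_trace

omit [Fintype A] in
theorem continuous_payoff_right (Φ : Matrix A A ℂ →ₗ[ℂ] Matrix B B ℂ)
    (C : Matrix (B × n) (B × n) ℂ) (J : Matrix (A × n) (A × n) ℂ) :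
    Continuous fun W => payoff Φ C J W :=
  Complex.continuous_re.comp (continuous_id.matrix_mul continuous_const).matrix_trace

/-- Comparing all `q` against `J` with all `K` against `p` packs both halves of the minimax equality
into one inequality. It is Sion's theorem for a payoff affine in each variable. -/
theorem exists_saddlePoint [DecidableEq n] [DecidableEq B] [Nonempty A] [Nonempty n]
    (Φ : Matrix A A ℂ →ₗ[ℂ] Matrix B B ℂ) (C : Matrix (B × n) (B × n) ℂ) :
    ∃ J ∈ choiSet n A, ∃ p ∈ dualSet n B, ∀ K ∈ choiSet n A, ∀ q ∈ dualSet n B,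
      payoff Φ C J q.2 ≤ payoff Φ C K p.2 := by
  let f : Matrix (A × n) (A × n) ℂ → Matrix n n ℂ × Matrix (B × n) (B × n) ℂ → ℝ :=
    fun J q => payoff Φ C J q.2
  have h1 : ∀ q ∈ dualSet n B, LowerSemicontinuousOn (fun J => f J q) (choiSet n A) := fun q _ =>
    (continuous_payoff_left Φ C q.2).lowerSemicontinuous.lowerSemicontinuousOn _
  have h2 : ∀ q ∈ dualSet n B, QuasiconvexOn ℝ (choiSet n A) fun J => f J q := fun q _ =>
    ConvexOn.quasiconvexOn ⟨convex_choiSet, fun J _ K _ a b _ _ hab =>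
      (payoff_smul_add_smul_left Φ C q.2 J K hab).le⟩
  have h3 : ∀ J ∈ choiSet n A, UpperSemicontinuousOn (fun q => f J q) (dualSet n B) := fun J _ =>
    ((continuous_payoff_right Φ C J).comp
      continuous_snd).upperSemicontinuous.upperSemicontinuousOn _
  have h4 : ∀ J ∈ choiSet n A, QuasiconcaveOn ℝ (dualSet n B) fun q => f J q := fun J _ =>
    ConcaveOn.quasiconcaveOn ⟨convex_dualSet, fun p _ q _ a b _ _ _ =>
      (payoff_smul_add_smul_right Φ C p.2 q.2 J a b).ge⟩
  exact Sion.exists_isSaddlePointOn choiSet_nonempty convex_choiSet isCompact_choiSet h1 h2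
    convex_dualSet dualSet_nonempty isCompact_dualSet h3 h4

end Dual

/-! ### Diamond norm of a difference of channels -/

section Diamond

variable {A B n R : Type*} [Fintype A] [Fintype B] [Fintype n] [Fintype R]
  [DecidableEq B] [DecidableEq n] [DecidableEq R]
  {Φ Φ' : Matrix n n ℂ →ₗ[ℂ] Matrix B B ℂ}

omit [DecidableEq B] [DecidableEq n] [DecidableEq R] in
theorem isHermitian_tensorId_sub (h : IsChannel Φ) (h' : IsChannel Φ')
    {ω : Matrix (n × R) (n × R) ℂ} (hω : ω.PosSemidef) :
    (tensorId (Φ - Φ') R ω).IsHermitian :=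
  (h.tensorId_posSemidef hω).isHermitian.sub (h'.tensorId_posSemidef hω).isHermitian

omit [DecidableEq n] in
-- Supplies the boundedness without which the real supremum defining the diamond norm would default
-- to zero.
theorem traceNorm_tensorId_sub_le_two (h : IsChannel Φ) (h' : IsChannel Φ')
    {ω : Matrix (n × R) (n × R) ℂ} (hω : ω ∈ states (n × R)) :
    traceNorm (tensorId (Φ - Φ') R ω) ≤ 2 := by
  have h1 := h.tensorId_mem_states hω
  have h2 := h'.tensorId_mem_states hω
  have := traceNorm_sub_le h1.1 h2.1
  rw [h1.2, h2.2, Complex.one_re] at this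
  rw [tensorId_sub]
  linarith

theorem le_diamondNorm (h : IsChannel Φ) (h' : IsChannel Φ') (e : n ≃ R)
    {ξ : Matrix (n × R) (n × R) ℂ} (hξ : ξ ∈ states (n × R)) :
    traceNorm (tensorId (Φ - Φ') R ξ) ≤ diamondNorm (Φ - Φ') := by
  have hs : ξ.submatrix (Prod.map id e) (Prod.map id e) ∈ states (n × n) :=
    ⟨hξ.1.submatrix _, (trace_submatrix_equiv ξ ((Equiv.refl n).prodCongr e)).trans hξ.2⟩
  have hb : BddAbove (Set.range fun ρ : states (n × n) => traceNorm (tensorId (Φ - Φ') n ρ)) :=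
    ⟨2, by rintro _ ⟨ρ, rfl⟩; exact traceNorm_tensorId_sub_le_two h h' ρ.2⟩
  have := le_ciSup hb ⟨_, hs⟩
  refine le_trans (le_of_eq ?_) this
  rw [tensorId_submatrix]
  exact (traceNorm_submatrix_equiv (isHermitian_tensorId_sub h h' hξ.1)
    ((Equiv.refl B).prodCongr e)).symm

theorem diamondNorm_nonneg (Ψ : Matrix n n ℂ →ₗ[ℂ] Matrix B B ℂ) : 0 ≤ diamondNorm Ψ :=
  Real.iSup_nonneg fun _ => traceNorm_nonneg _

/-- At each test state the trace norm is attained by some `M`, and pulling `M` back gives an element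
of `dualSet` with the same pairing. -/
theorem diamondNorm_le_of_dual [Nonempty n] (h : IsChannel Φ) (h' : IsChannel Φ') {c : ℝ}
    (hc : ∀ q ∈ dualSet n B, (q.2 * choi (Φ - Φ')).trace.re ≤ c) :
    diamondNorm (Φ - Φ') ≤ c := by
  have : Nonempty (states (n × n)) := states_nonempty.to_subtype
  refine ciSup_le fun ω => ?_
  obtain ⟨M, h1, h2, h3⟩ :=
    exists_re_trace_mul_eq_traceNorm (isHermitian_tensorId_sub h h' ω.2.1)
  rw [← h3, trace_mul_tensorId]
  refine hc (_, pullback M ω) ⟨reduceRight_transpose_mem_states ω.2, ?_, ?_⟩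
  · change ((1 : Matrix B B ℂ) ⊗ₖ (_)ᵀ - pullback M _).PosSemidef
    rw [← pullback_one, ← pullback_sub]
    exact posSemidef_pullback h1 ω.2.1
  · change ((1 : Matrix B B ℂ) ⊗ₖ (_)ᵀ + pullback M _).PosSemidef
    rw [← pullback_one, ← pullback_add]
    exact posSemidef_pullback h2 ω.2.1

theorem diamondNorm_sub_eq_zero_iff [Nonempty n] (h : IsChannel Φ) (h' : IsChannel Φ') :
    diamondNorm (Φ - Φ') = 0 ↔ Φ = Φ' := by
  constructor
  · intro h0
    -- The maximally entangled state suffices as a test: its output is a nonzero multiple of the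
    -- Choi matrix.
    have hs := smul_entangled_mem_states (id : n → n)
    have h1 := le_diamondNorm h h' (Equiv.refl n) hs
    rw [h0] at h1
    have h2 := eq_zero_of_traceNorm_eq_zero (le_antisymm h1 (traceNorm_nonneg _))
    rw [LinearMap.map_smul_of_tower, tensorId_entangled_id, smul_eq_zero] at h2
    have h3 : choi (Φ - Φ') = 0 := h2.resolve_left (by positivity)
    rw [choi_sub, sub_eq_zero] at h3
    rw [← ofChoi_choi Φ, h3, ofChoi_choi]
  · rintro rfl
    refine le_antisymm (diamondNorm_le_of_dual h h fun q _ => ?_) (diamondNorm_nonneg _)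
    rw [choi_sub, sub_self, mul_zero, trace_zero, Complex.zero_re]

end Diamond

/-! ### Pure states of full Schmidt rank -/

section Factor

variable {A B n R : Type*} [Fintype A] [Fintype B] [Fintype n] [Fintype R]

theorem exists_conjTranspose_mul_self_eq [DecidableEq n] [DecidableEq R] {ρ : Matrix n n ℂ}
    (hρ : ρ.PosDef) (e : n ≃ R) :
    ∃ (V : Matrix R n ℂ) (U : Matrix n R ℂ), V * U = 1 ∧ U * V = 1 ∧ Vᴴ * V = ρ := by
  obtain ⟨Z, hZ⟩ := CStarAlgebra.nonneg_iff_eq_star_mul_self.mp hρ.posSemidef.nonneg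
  have hu : IsUnit Z.det := by
    have := (isUnit_iff_isUnit_det _).1 hρ.isUnit
    rw [hZ, det_mul] at this
    exact isUnit_of_mul_isUnit_right this
  refine ⟨Z.submatrix e.symm id, Z⁻¹.submatrix id e.symm, ?_, ?_, ?_⟩
  · rw [submatrix_mul _ _ e.symm id e.symm Function.bijective_id |>.symm, mul_nonsing_inv _ hu,
      submatrix_one_equiv]
  · rw [submatrix_mul _ _ id e.symm id e.symm.bijective |>.symm, nonsing_inv_mul _ hu,
      submatrix_id_id]
  · rw [conjTranspose_submatrix, submatrix_mul _ _ id e.symm id e.symm.bijective |>.symm,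
      submatrix_id_id, hZ, star_eq_conjTranspose]

omit [Fintype R] in
theorem one_kronecker_mul_mul_apply [DecidableEq A] (V : Matrix R n ℂ)
    (J : Matrix (A × n) (A × n) ℂ) (x y : A × R) :
    (((1 : Matrix A A ℂ) ⊗ₖ V) * J * ((1 : Matrix A A ℂ) ⊗ₖ V)ᴴ) x y =
      ∑ i, ∑ j, V x.2 i * star (V y.2 j) * J (x.1, i) (y.1, j) := by
  simp only [mul_apply, conjTranspose_apply, kroneckerMap_apply, Fintype.sum_prod_type, one_apply,
    ite_mul, one_mul, zero_mul, apply_ite star, star_zero, mul_ite, mul_zero,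
    Finset.sum_ite_irrel, Finset.sum_const_zero, Finset.sum_ite_eq, Finset.mem_univ, if_true,
    Finset.sum_mul]
  rw [Finset.sum_comm]
  exact Finset.sum_congr rfl fun i _ => Finset.sum_congr rfl fun j _ => by ring

omit [Fintype R] in
theorem reduceRight_one_kronecker_mul_mul [DecidableEq A] (V : Matrix R n ℂ)
    (J : Matrix (A × n) (A × n) ℂ) :
    reduceRight (((1 : Matrix A A ℂ) ⊗ₖ V) * J * ((1 : Matrix A A ℂ) ⊗ₖ V)ᴴ) =
      V * reduceRight J * Vᴴ := by
  ext r s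
  simp only [reduceRight, of_apply, one_kronecker_mul_mul_apply]
  simp only [mul_apply, of_apply, conjTranspose_apply, Finset.sum_mul, Finset.mul_sum]
  rw [Finset.sum_comm]
  rw [Finset.sum_comm (s := (Finset.univ : Finset n)) (t := (Finset.univ : Finset n))]
  refine Finset.sum_congr rfl fun i _ => ?_
  rw [Finset.sum_comm]
  exact Finset.sum_congr rfl fun j _ => Finset.sum_congr rfl fun a _ => by ring

/-- The vector state with coefficient matrix `V`. -/
def pureState (V : Matrix R n ℂ) : Matrix (n × R) (n × R) ℂ :=
  vecMulVec (fun x => V x.2 x.1) (star fun x => V x.2 x.1)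

theorem pureState_mem_states {V : Matrix R n ℂ} (hV : (Vᴴ * V).trace = 1) :
    pureState V ∈ states (n × R) := by
  refine ⟨posSemidef_vecMulVec_self_star _, ?_⟩
  rw [← hV]
  simp only [trace, diag, pureState, vecMulVec_apply, Pi.star_apply, Fintype.sum_prod_type,
    mul_apply, conjTranspose_apply]
  exact Finset.sum_congr rfl fun i _ => Finset.sum_congr rfl fun j _ => mul_comm _ _

omit [Fintype R] in
theorem reduceRight_pureState (V : Matrix R n ℂ) : reduceRight (pureState V) = V * Vᴴ := by
  ext r s
  simp [reduceRight, pureState, vecMulVec_apply, mul_apply]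

omit [Fintype R] in
theorem tensorId_pureState [DecidableEq n] [DecidableEq B] (Ψ : Matrix n n ℂ →ₗ[ℂ] Matrix B B ℂ)
    (V : Matrix R n ℂ) :
    tensorId Ψ R (pureState V) =
      ((1 : Matrix B B ℂ) ⊗ₖ V) * choi Ψ * ((1 : Matrix B B ℂ) ⊗ₖ V)ᴴ := by
  ext x y
  rw [tensorId_eq_sum_choi, one_kronecker_mul_mul_apply]
  rfl

/-- Every operator with the same marginal as a pure state of full Schmidt rank is the image of that
pure state under a channel. -/
theorem exists_choi_tensorId_pureState [DecidableEq n] [DecidableEq R] [DecidableEq A]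
    {V : Matrix R n ℂ} {U : Matrix n R ℂ} (hVU : V * U = 1) (hUV : U * V = 1)
    {σ : Matrix (A × R) (A × R) ℂ} (hσ : σ.PosSemidef)
    (h : reduceRight σ = reduceRight (pureState V)) :
    ∃ J ∈ choiSet n A, tensorId (ofChoi J) R (pureState V) = σ := by
  -- On Choi matrices, the pure state acts as conjugation by `1 ⊗ V`; conjugating `σ` by `1 ⊗ U`
  -- undoes it. The marginal `V V*` becomes `U V V* U* = 1`, which is trace preservation.
  refine ⟨((1 : Matrix A A ℂ) ⊗ₖ U) * σ * ((1 : Matrix A A ℂ) ⊗ₖ U)ᴴ,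
    ⟨hσ.mul_mul_conjTranspose_same _, ?_⟩, ?_⟩
  · have h2 : Vᴴ * Uᴴ = 1 := by rw [← conjTranspose_mul, hUV, conjTranspose_one]
    rw [reduceRight_one_kronecker_mul_mul, h, reduceRight_pureState, ← Matrix.mul_assoc, hUV,
      Matrix.one_mul, h2]
  · have hk : ((1 : Matrix A A ℂ) ⊗ₖ V) * ((1 : Matrix A A ℂ) ⊗ₖ U) = 1 := by
      rw [← mul_kronecker_mul, hVU, Matrix.mul_one, one_kronecker_one]
    have hk' : ((1 : Matrix A A ℂ) ⊗ₖ U)ᴴ * ((1 : Matrix A A ℂ) ⊗ₖ V)ᴴ = 1 := by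
      rw [← conjTranspose_mul, hk, conjTranspose_one]
    rw [tensorId_pureState, choi_ofChoi, Matrix.mul_assoc, Matrix.mul_assoc, hk',
      Matrix.mul_one, ← Matrix.mul_assoc, hk, Matrix.one_mul]

/-- Reverse of the pullback: with `K = 1 ⊗ V` and inverse `L`, the bound `±W ≤ K* K` becomes `±L* W
L ≤ 1`. So `L* W L` is an admissible test operator, and cyclicity of the trace keeps the pairing. -/
theorem re_trace_mul_choi_le_traceNorm [DecidableEq n] [DecidableEq R] [DecidableEq B]
    {V : Matrix R n ℂ} {U : Matrix n R ℂ} (hVU : V * U = 1) (hUV : U * V = 1)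
    {W : Matrix (B × n) (B × n) ℂ} (h1 : ((1 : Matrix B B ℂ) ⊗ₖ (Vᴴ * V) - W).PosSemidef)
    (h2 : ((1 : Matrix B B ℂ) ⊗ₖ (Vᴴ * V) + W).PosSemidef)
    {Ψ : Matrix n n ℂ →ₗ[ℂ] Matrix B B ℂ} (hΨ : (tensorId Ψ R (pureState V)).IsHermitian) :
    (W * choi Ψ).trace.re ≤ traceNorm (tensorId Ψ R (pureState V)) := by
  let K : Matrix (B × R) (B × n) ℂ := (1 : Matrix B B ℂ) ⊗ₖ V
  let L : Matrix (B × n) (B × R) ℂ := (1 : Matrix B B ℂ) ⊗ₖ U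
  have hKL : K * L = 1 := by
    simp only [K, L]
    rw [← mul_kronecker_mul, hVU, Matrix.mul_one, one_kronecker_one]
  have hLK : L * K = 1 := by
    simp only [K, L]
    rw [← mul_kronecker_mul, hUV, Matrix.mul_one, one_kronecker_one]
  have hKL' : Lᴴ * Kᴴ = 1 := by rw [← conjTranspose_mul, hKL, conjTranspose_one]
  have hLK' : Kᴴ * Lᴴ = 1 := by rw [← conjTranspose_mul, hLK, conjTranspose_one]
  have hρ : (1 : Matrix B B ℂ) ⊗ₖ (Vᴴ * V) = Kᴴ * K := by
    simp only [K]
    rw [conjTranspose_kronecker, ← mul_kronecker_mul, conjTranspose_one, Matrix.mul_one]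
  have hone : Lᴴ * (Kᴴ * K) * L = 1 := by
    rw [← Matrix.mul_assoc, hKL', Matrix.one_mul, hKL]
  have m1 := h1.conjTranspose_mul_mul_same L
  have m2 := h2.conjTranspose_mul_mul_same L
  rw [hρ, Matrix.mul_sub, Matrix.sub_mul, hone] at m1
  rw [hρ, Matrix.mul_add, Matrix.add_mul, hone] at m2
  refine le_trans (le_of_eq ?_) (re_trace_mul_le_traceNorm hΨ m1 m2)
  rw [tensorId_pureState]
  change _ = ((Lᴴ * W * L) * (K * choi Ψ * Kᴴ)).trace.re
  rw [← Matrix.mul_assoc, trace_mul_comm _ Kᴴ]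
  have : Kᴴ * (Lᴴ * W * L * (K * choi Ψ)) = W * choi Ψ := by
    calc _ = (Kᴴ * Lᴴ) * W * ((L * K) * choi Ψ) := by simp only [Matrix.mul_assoc]
      _ = _ := by rw [hLK', hLK, Matrix.one_mul, Matrix.one_mul]
  rw [this]

theorem exists_pureState_payoff_le [DecidableEq n] [DecidableEq R] [DecidableEq B] [Nonempty n]
    {Φ₁ : Matrix A A ℂ →ₗ[ℂ] Matrix B B ℂ} {Φ₂ : Matrix n n ℂ →ₗ[ℂ] Matrix B B ℂ}
    (h₁ : IsChannel Φ₁) (h₂ : IsChannel Φ₂) (e : n ≃ R)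
    {p : Matrix n n ℂ × Matrix (B × n) (B × n) ℂ} (hp : p ∈ dualSet n B) {c : ℝ}
    (hc : ∀ J ∈ choiSet n A, c ≤ payoff Φ₁ (choi Φ₂) J p.2) {t : ℝ} (ht : 0 < t) (ht1 : t ≤ 1) :
    ∃ ξ ∈ states (n × R), ∀ σ ∈ states (A × R), reduceRight σ = reduceRight ξ →
      (1 - t) * c ≤ traceNorm (tensorId Φ₁ R σ - tensorId Φ₂ R ξ) := by
  classical
  obtain ⟨hρ, hW1, hW2⟩ := hp
  have hn : 0 < t * (Fintype.card n : ℝ)⁻¹ := by positivity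
  have ht0 : 0 ≤ 1 - t := by linarith
  -- Mixing with the maximally mixed state makes `ρ'` invertible. Shrinking `W` by `1 - t` keeps the
  -- two operator inequalities valid.
  let ρ' : Matrix n n ℂ := (1 - t) • p.1 + (t * (Fintype.card n : ℝ)⁻¹) • (1 : Matrix n n ℂ)
  have hρ' : ρ'.PosDef := PosDef.posSemidef_add (hρ.1.smul ht0) (PosDef.one.smul hn)
  have htr : ρ'.trace = 1 := by
    simp only [ρ', trace_add, trace_smul, hρ.2, trace_one]
    have : (Fintype.card n : ℂ) ≠ 0 := by simp
    simp [this]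
  obtain ⟨V, U, hVU, hUV, hV⟩ := exists_conjTranspose_mul_self_eq hρ' e
  have hk : (1 : Matrix B B ℂ) ⊗ₖ (Vᴴ * V) = (1 - t) • ((1 : Matrix B B ℂ) ⊗ₖ p.1) +
      (t * (Fintype.card n : ℝ)⁻¹) • (1 : Matrix (B × n) (B × n) ℂ) := by
    rw [hV]
    simp only [ρ', kronecker_add, kronecker_smul, one_kronecker_one]
  have hone := (PosSemidef.one (n := B × n) (R := ℂ)).smul hn.le
  have m1 : ((1 : Matrix B B ℂ) ⊗ₖ (Vᴴ * V) - (1 - t) • p.2).PosSemidef := by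
    rw [hk, add_sub_right_comm, ← smul_sub]
    exact (hW1.smul ht0).add hone
  have m2 : ((1 : Matrix B B ℂ) ⊗ₖ (Vᴴ * V) + (1 - t) • p.2).PosSemidef := by
    rw [hk, add_right_comm, ← smul_add]
    exact (hW2.smul ht0).add hone
  have hs : pureState V ∈ states (n × R) := pureState_mem_states (by rw [hV, htr])
  refine ⟨pureState V, hs, fun σ hσ hr => ?_⟩
  -- Here the marginal constraint is used: it turns the arbitrary competitor `σ` into a channel
  -- applied to the pure state, against which `hc` applies.
  obtain ⟨J, hJ, rfl⟩ := exists_choi_tensorId_pureState hVU hUV hσ.1 hr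
  have hch : IsChannel (Φ₁ ∘ₗ ofChoi J) := h₁.comp (isChannel_ofChoi hJ.1 hJ.2)
  have hmain := re_trace_mul_choi_le_traceNorm hVU hUV m1 m2
    (isHermitian_tensorId_sub hch h₂ hs.1)
  rw [smul_mul_assoc, trace_smul, Complex.smul_re, ← payoff_eq, tensorId_sub,
    tensorId_comp] at hmain
  exact (mul_le_mul_of_nonneg_left (hc J hJ) ht0).trans hmain

end Factor

theorem le_of_forall_one_sub_mul_le {c b : ℝ} (h : ∀ t : ℝ, 0 < t → t ≤ 1 → (1 - t) * c ≤ b) :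
    c ≤ b := by
  have hlim : Filter.Tendsto (fun t : ℝ => (1 - t) * c) (nhdsWithin 0 (Set.Ioi 0)) (nhds c) := by
    have : Continuous fun t : ℝ => (1 - t) * c := by fun_prop
    simpa using (this.tendsto 0).mono_left nhdsWithin_le_nhds
  refine le_of_tendsto hlim ?_
  filter_upwards [Ioc_mem_nhdsGT (zero_lt_one' ℝ)] with t ht using h t ht.1 ht.2

/-! ### Optimal channels, the sup-inf formula and ranges -/

section Main

variable {A B n R : Type*} [Fintype A] [Nonempty A] [Fintype B] [DecidableEq B] [Fintype n]
  [DecidableEq n] [Nonempty n] [Fintype R]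
  {Φ₁ : Matrix A A ℂ →ₗ[ℂ] Matrix B B ℂ} {Φ₂ : Matrix n n ℂ →ₗ[ℂ] Matrix B B ℂ}

omit [Nonempty A] [Nonempty n] in
theorem preDeficiency_le {Λ : Matrix n n ℂ →ₗ[ℂ] Matrix A A ℂ} (hΛ : IsChannel Λ) :
    preDeficiency Φ₁ Φ₂ ≤ diamondNorm (Φ₁ ∘ₗ Λ - Φ₂) :=
  ciInf_le (f := fun Λ : {Λ : Matrix n n ℂ →ₗ[ℂ] Matrix A A ℂ // IsChannel Λ} =>
    diamondNorm (Φ₁ ∘ₗ Λ.1 - Φ₂))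
    ⟨0, by rintro _ ⟨Λ, rfl⟩; exact diamondNorm_nonneg _⟩ ⟨Λ, hΛ⟩

/-- The deficiency is attained, and it is the value of the game with payoff `payoff`. -/
theorem exists_optimal (h₁ : IsChannel Φ₁) (h₂ : IsChannel Φ₂) :
    (∃ Λ : Matrix n n ℂ →ₗ[ℂ] Matrix A A ℂ, IsChannel Λ ∧
      diamondNorm (Φ₁ ∘ₗ Λ - Φ₂) = preDeficiency Φ₁ Φ₂) ∧
    ∃ p ∈ dualSet n B, ∀ J ∈ choiSet n A, preDeficiency Φ₁ Φ₂ ≤ payoff Φ₁ (choi Φ₂) J p.2 := by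
  obtain ⟨J, hJ, p, hp, hs⟩ := exists_saddlePoint Φ₁ (choi Φ₂)
  have hΛ := isChannel_ofChoi hJ.1 hJ.2
  have hD : ∀ K ∈ choiSet n A,
      diamondNorm (Φ₁ ∘ₗ ofChoi J - Φ₂) ≤ payoff Φ₁ (choi Φ₂) K p.2 := fun K hK =>
    diamondNorm_le_of_dual (h₁.comp hΛ) h₂ fun q hq => by
      rw [← payoff_eq]
      exact hs K hK q hq
  have hmin : diamondNorm (Φ₁ ∘ₗ ofChoi J - Φ₂) = preDeficiency Φ₁ Φ₂ := by
    refine le_antisymm ?_ (preDeficiency_le hΛ)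
    have : Nonempty {Λ : Matrix n n ℂ →ₗ[ℂ] Matrix A A ℂ // IsChannel Λ} := ⟨⟨_, hΛ⟩⟩
    refine le_ciInf fun ⟨Λ, hΛ⟩ => le_of_forall_one_sub_mul_le fun t ht ht1 => ?_
    -- The saddle channel beats any `Λ`: the state `ξ` from `p` detects an error of at least `(1 -
    -- t)` times the saddle norm, already with `σ = (Λ ⊗ id)(ξ)`.
    obtain ⟨ξ, hξ, hle⟩ := exists_pureState_payoff_le h₁ h₂ (Equiv.refl n) hp hD ht ht1
    exact (hle _ (hΛ.tensorId_mem_states hξ) (reduceRight_tensorId hΛ.trace_preserving ξ)).trans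
      (le_diamondNorm (h₁.comp hΛ) h₂ (Equiv.refl n) hξ)
  exact ⟨⟨_, hΛ, hmin⟩, p, hp, hmin ▸ hD⟩

theorem isLUB_preDeficiency [DecidableEq R] (h₁ : IsChannel Φ₁) (h₂ : IsChannel Φ₂) (e : n ≃ R) :
    IsLUB
      (Set.range fun ξ : states (n × R) =>
        ⨅ σ : {σ : Matrix (A × R) (A × R) ℂ // σ ∈ states (A × R) ∧
            reduceRight σ = reduceRight (ξ : Matrix (n × R) (n × R) ℂ)},
          traceNorm (tensorId Φ₁ R σ.1 - tensorId Φ₂ R ξ))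
      (preDeficiency Φ₁ Φ₂) := by
  obtain ⟨⟨Λ, hΛ, hmin⟩, p, hp, hle⟩ := exists_optimal h₁ h₂
  constructor
  · rintro _ ⟨ξ, rfl⟩
    have hb : BddBelow (Set.range fun σ : {σ : Matrix (A × R) (A × R) ℂ // σ ∈ states (A × R) ∧
        reduceRight σ = reduceRight (ξ : Matrix (n × R) (n × R) ℂ)} =>
          traceNorm (tensorId Φ₁ R σ.1 - tensorId Φ₂ R ξ)) :=
      ⟨0, by rintro _ ⟨σ, rfl⟩; exact traceNorm_nonneg _⟩
    -- The optimal channel yields a competitor with the correct marginal for every `ξ` at once.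
    refine (ciInf_le hb ⟨tensorId Λ R ξ, hΛ.tensorId_mem_states ξ.2,
      reduceRight_tensorId hΛ.trace_preserving _⟩).trans ?_
    rw [← hmin]
    exact le_diamondNorm (h₁.comp hΛ) h₂ e ξ.2
  · intro b hb
    refine le_of_forall_one_sub_mul_le fun t ht ht1 => ?_
    obtain ⟨ξ, hξ, hξle⟩ := exists_pureState_payoff_le h₁ h₂ e hp hle ht ht1
    refine le_trans ?_ (hb ⟨⟨ξ, hξ⟩, rfl⟩)
    have : Nonempty {σ : Matrix (A × R) (A × R) ℂ // σ ∈ states (A × R) ∧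
        reduceRight σ = reduceRight ξ} :=
      ⟨⟨tensorId Λ R ξ, hΛ.tensorId_mem_states hξ, reduceRight_tensorId hΛ.trace_preserving _⟩⟩
    exact le_ciInf fun σ => hξle σ.1 σ.2.1 σ.2.2

theorem preDeficiency_eq_zero_iff (h₁ : IsChannel Φ₁) (h₂ : IsChannel Φ₂) :
    preDeficiency Φ₁ Φ₂ = 0 ↔
      ∃ Λ : Matrix n n ℂ →ₗ[ℂ] Matrix A A ℂ, IsChannel Λ ∧ Φ₁ ∘ₗ Λ = Φ₂ := by
  constructor
  · intro h0
    obtain ⟨⟨Λ, hΛ, hmin⟩, -⟩ := exists_optimal h₁ h₂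
    exact ⟨Λ, hΛ, (diamondNorm_sub_eq_zero_iff (h₁.comp hΛ) h₂).1 (hmin.trans h0)⟩
  · rintro ⟨Λ, hΛ, h⟩
    refine le_antisymm ?_ (Real.iInf_nonneg fun _ => diamondNorm_nonneg _)
    rw [← (diamondNorm_sub_eq_zero_iff (h₁.comp hΛ) h₂).2 h]
    exact preDeficiency_le hΛ

omit [Nonempty A] [DecidableEq B] in
-- For the converse, only the maximally entangled state is tested. The inclusion says nothing about
-- the marginal of the preimage `σ`, but both maps preserve the trace, so the marginal is forced on
-- the relevant block.
theorem channelRange_subset_iff (h₁ : IsChannel Φ₁) (h₂ : IsChannel Φ₂)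
    (hR : Fintype.card n ≤ Fintype.card R) :
    (∃ Λ : Matrix n n ℂ →ₗ[ℂ] Matrix A A ℂ, IsChannel Λ ∧ Φ₁ ∘ₗ Λ = Φ₂) ↔
      channelRange (tensorId Φ₂ R) ⊆ channelRange (tensorId Φ₁ R) := by
  classical
  constructor
  · rintro ⟨Λ, hΛ, rfl⟩ _ ⟨ξ, hξ, rfl⟩
    exact ⟨tensorId Λ R ξ, hΛ.tensorId_mem_states hξ, rfl⟩
  · intro h
    obtain ⟨f⟩ := Function.Embedding.nonempty_of_card_le hR
    obtain ⟨σ, hσ, hσξ⟩ := h ⟨_, smul_entangled_mem_states f, rfl⟩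
    have hn : (Fintype.card n : ℝ) ≠ 0 := by simp
    -- Cutting to the image of `f` discards the unused part of the ancilla, and the factor undoes
    -- the normalisation of the entangled state.
    let J : Matrix (A × n) (A × n) ℂ :=
      (Fintype.card n : ℝ) • σ.submatrix (Prod.map id f) (Prod.map id f)
    have hchoi : tensorId Φ₁ n J = choi Φ₂ := by
      simp only [J]
      rw [LinearMap.map_smul_of_tower, tensorId_submatrix, hσξ, LinearMap.map_smul_of_tower,
        submatrix_smul, Pi.smul_apply, Pi.smul_apply, tensorId_entangled_submatrix Φ₂ f.injective,
        smul_inv_smul₀ hn]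
    have hJ1 : J.PosSemidef := (hσ.1.submatrix _).smul (Nat.cast_nonneg _)
    have hJ2 : reduceRight J = 1 := by
      rw [← reduceRight_tensorId h₁.trace_preserving, hchoi, h₂.reduceRight_choi]
    refine ⟨ofChoi J, isChannel_ofChoi hJ1 hJ2, ?_⟩
    rw [← ofChoi_choi (Φ₁ ∘ₗ ofChoi J), choi_comp_ofChoi, hchoi, ofChoi_choi]

end Main

end QuantumComparison

theorem mainTheorem6 {A₀ A₀' A₁ : Type*} [Fintype A₀] [Nonempty A₀]
    [Fintype A₀'] [DecidableEq A₀'] [Nonempty A₀'] [Fintype A₁] [DecidableEq A₁]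
    (Φ₁ : Matrix A₀ A₀ ℂ →ₗ[ℂ] Matrix A₁ A₁ ℂ) (Φ₂ : Matrix A₀' A₀' ℂ →ₗ[ℂ] Matrix A₁ A₁ ℂ)
    (h₁ : QuantumComparison.IsChannel Φ₁) (h₂ : QuantumComparison.IsChannel Φ₂) :
    -- the infimum in the definition of the deficiency is a minimum
    (∃ Λ : Matrix A₀' A₀' ℂ →ₗ[ℂ] Matrix A₀ A₀ ℂ, QuantumComparison.IsChannel Λ ∧
      QuantumComparison.diamondNorm (Φ₁ ∘ₗ Λ - Φ₂) = QuantumComparison.preDeficiency Φ₁ Φ₂) ∧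
    -- the sup-inf formula, for every ancilla `R ≃ A₀'`
    (∀ (R : Type*) [Fintype R] [DecidableEq R], Fintype.card R = Fintype.card A₀' →
      IsLUB
        (Set.range fun ξ : QuantumComparison.states (A₀' × R) =>
          ⨅ σ : {σ : Matrix (A₀ × R) (A₀ × R) ℂ // σ ∈ QuantumComparison.states (A₀ × R) ∧
              QuantumComparison.reduceRight σ =
                QuantumComparison.reduceRight (ξ : Matrix (A₀' × R) (A₀' × R) ℂ)},
            QuantumComparison.traceNorm
              (QuantumComparison.tensorId Φ₁ R σ.1 - QuantumComparison.tensorId Φ₂ R ξ))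
        (QuantumComparison.preDeficiency Φ₁ Φ₂)) ∧
    -- exact simulability and inclusion of ranges, for every ancilla with `d_R ≥ d_{A₀'}`
    (∀ (R : Type*) [Fintype R], Fintype.card A₀' ≤ Fintype.card R →
      (QuantumComparison.preDeficiency Φ₁ Φ₂ = 0 ↔
        QuantumComparison.channelRange (QuantumComparison.tensorId Φ₂ R) ⊆
          QuantumComparison.channelRange (QuantumComparison.tensorId Φ₁ R)) ∧
      ((∃ Λ : Matrix A₀' A₀' ℂ →ₗ[ℂ] Matrix A₀ A₀ ℂ,
          QuantumComparison.IsChannel Λ ∧ Φ₁ ∘ₗ Λ = Φ₂) ↔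
        QuantumComparison.channelRange (QuantumComparison.tensorId Φ₂ R) ⊆
          QuantumComparison.channelRange (QuantumComparison.tensorId Φ₁ R))) := by
  refine ⟨(QuantumComparison.exists_optimal h₁ h₂).1, fun R _ _ hR => ?_, fun R _ hR => ?_⟩
  · exact QuantumComparison.isLUB_preDeficiency h₁ h₂ (Fintype.equivOfCardEq hR.symm)
  · have h := QuantumComparison.channelRange_subset_iff h₁ h₂ hR
    exact ⟨(QuantumComparison.preDeficiency_eq_zero_iff h₁ h₂).trans h, h⟩
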